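/- Let $(\widehat M,\widehat g)$ be a semi-Riemannian manifold (a finite-dimensional smooth manifold without boundary with a smooth symmetric nondegenerate $(0,2)$-tensor field $\widehat g$) and let $F:\widehat M\to\mathbb R$ be a smooth function. Let $\overline M=\mathbb R\times\widehat M$ with the semi-Riemannian metric $\overline g=-dx^0\otimes dx^0+\pi^*\widehat g$, where $\pi:\overline M\to\widehat M$ is the projection and $x^0$ is the coordinate on the factor $\mathbb R$, and let $M$ be the hypersurface $$M=\{(t,p)\in\overline M : t=F(p)\}.$$ Let $\overline\nabla$ be the Levi-Civita connection of $(\overline M,\overline g)$ and let $$\xi=\frac{\partial}{\partial x^0}+(\operatorname{grad}_{\widehat g}F)_L,$$ where, for a vector field $Z$ on $\widehat M$, $Z_L$ denotes its lift to $\overline M$, i.e. the vector field on $\overline M$ that projects to $0$ on $\mathbb R$ and to $Z$ on $\widehat M$. For smooth tangent vector fields $X,Y\in\Gamma(TM)$ on $M$ let $B_\xi(X,Y)=\overline g(\overline\nabla_XY,\xi)$ be the second fundamental form of $M$ with respect to $\xi$, where $\overline\nabla_XY$ is computed with any local smooth extension of $Y$ to $\overline M$. Then at every point of $M$ $$B_\xi(X,Y)=-\operatorname{Hess}(F)(\pi_*X,\pi_*Y)\qquad\text{for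 all }X,Y\in\Gamma(TM),$$ where $\operatorname{Hess}(F)(U,V)=U(VF)-(\widehat\nabla_UV)F$ is the Hessian of $F$ in $(\widehat M,\widehat g)$ and $\widehat\nabla$ is the Levi-Civita connection of $\widehat g$. -/

import Mathlib

open Bundle Filter
open scoped Manifold ContDiff Topology

noncomputable section

/-! ### Semi-Riemannian metrics -/

section Metric

variable {E : Type*} [NormedAddCommGroup E] [NormedSpace ℝ E]
  {H : Type*} [TopologicalSpace H] (I : ModelWithCorners ℝ E H)
  (M : Type*) [TopologicalSpace M] [ChartedSpace H M]

/-- A semi-Riemannian metric on a smooth manifold: a smooth symmetric `(0,2)`-tensor field which is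
nondegenerate at every point. The index is locally constant, hence constant when the
manifold is connected; on a disconnected manifold it is allowed to vary. -/
structure SemiRiemannianMetric [IsManifold I ∞ M] where
  /-- The bilinear form on each tangent space. -/
  inner : ∀ x : M, TangentSpace I x →L[ℝ] TangentSpace I x →L[ℝ] ℝ
  symm : ∀ (x : M) (v w : TangentSpace I x), inner x v w = inner x w v
  nondegenerate : ∀ (x : M) (v : TangentSpace I x), (∀ w, inner x v w = 0) → v = 0
  contMDiff : ContMDiff I (I.prod 𝓘(ℝ, E →L[ℝ] E →L[ℝ] ℝ)) ∞
    (fun x ↦ TotalSpace.mk' (E →L[ℝ] E →L[ℝ] ℝ) x (inner x))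

variable {I M}

/-- A nondegenerate bilinear form on a finite-dimensional space identifies it with its dual. -/
theorem bijective_of_nondegenerate [FiniteDimensional ℝ E] (B : E →L[ℝ] E →L[ℝ] ℝ)
    (hB : ∀ v, (∀ w, B v w = 0) → v = 0) : Function.Bijective B := by
  have hinj : Function.Injective (B : E →ₗ[ℝ] (E →L[ℝ] ℝ)) := by
    rw [← LinearMap.ker_eq_bot, LinearMap.ker_eq_bot']
    intro v hv
    exact hB v fun w ↦ by simpa using congr($hv w)
  have hfin : Module.finrank ℝ E = Module.finrank ℝ (E →L[ℝ] ℝ) := by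
    rw [← (LinearMap.toContinuousLinearMap (𝕜 := ℝ) (E := E) (F' := ℝ)).finrank_eq]
    exact Subspace.dual_finrank_eq.symm
  exact ⟨hinj, (LinearMap.injective_iff_surjective_of_finrank_eq_finrank hfin).1 hinj⟩

namespace SemiRiemannianMetric

variable [IsManifold I ∞ M]

/-- The metric isomorphism `v ↦ g(v, ·)` from `T_x M` to its dual. -/
def flat [FiniteDimensional ℝ E] (g : SemiRiemannianMetric I M) (x : M) :
    TangentSpace I x ≃ₗ[ℝ] (TangentSpace I x →L[ℝ] ℝ) :=
  LinearEquiv.ofBijective (g.inner x : TangentSpace I x →ₗ[ℝ] (TangentSpace I x →L[ℝ] ℝ))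
    (bijective_of_nondegenerate (E := E) (g.inner x) (g.nondegenerate x))

/-- The inverse of the metric isomorphism: `sharp x φ` is the unique vector with
`g(sharp x φ, ·) = φ`. -/
def sharp [FiniteDimensional ℝ E] (g : SemiRiemannianMetric I M) (x : M) :
    (TangentSpace I x →L[ℝ] ℝ) ≃ₗ[ℝ] TangentSpace I x :=
  (g.flat x).symm

theorem inner_sharp [FiniteDimensional ℝ E] (g : SemiRiemannianMetric I M) (x : M) (φ : TangentSpace I x →L[ℝ] ℝ) :
    g.inner x (g.sharp x φ) = φ :=
  (g.flat x).apply_symm_apply φ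

/-- The gradient of a function: `g(grad f, ·) = df`. -/
def grad [FiniteDimensional ℝ E] (g : SemiRiemannianMetric I M) (f : M → ℝ) (x : M) : TangentSpace I x :=
  g.sharp x (mvfderiv I f x)

theorem mdifferentiableAt_inner (g : SemiRiemannianMetric I M)
    {σ τ : Π x : M, TangentSpace I x} {x : M} (hσ : MDiffAt (T% σ) x) (hτ : MDiffAt (T% τ) x) :
    MDiffAt (fun y ↦ g.inner y (σ y) (τ y)) x := by
  have : MDifferentiableAt I (I.prod 𝓘(ℝ))
      (fun m ↦ TotalSpace.mk' ℝ (E := Bundle.Trivial M ℝ) m (g.inner m (σ m) (τ m))) x := by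
    apply MDifferentiableAt.clm_bundle_apply₂ (F₁ := E) (F₂ := E)
    · exact (g.contMDiff x).mdifferentiableAt (by simp)
    · exact hσ
    · exact hτ
  simp only [mdifferentiableAt_totalSpace] at this
  exact this.2

end SemiRiemannianMetric

end Metric

/-! ### The Levi-Civita connection -/

section LeviCivita

variable {E : Type*} [NormedAddCommGroup E] [NormedSpace ℝ E]
  {H : Type*} [TopologicalSpace H] {I : ModelWithCorners ℝ E H}
  {M : Type*} [TopologicalSpace M] [ChartedSpace H M]

theorem mvfderiv_congr_of_eventuallyEq {F : Type*} [NormedAddCommGroup F] [NormedSpace ℝ F]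
    {f f' : M → F} {x : M} (h : f =ᶠ[𝓝 x] f') : mvfderiv I f x = mvfderiv I f' x := by
  ext v
  exact congr($(h.mfderiv_eq (I := I) (I' := 𝓘(ℝ, F))) v)

variable [IsManifold I ∞ M]

/-- A connection `∇` on the tangent bundle is a Levi-Civita connection of `g` if it is torsion-free
and compatible with `g`. Here `∇ Y x v` is the value at `x` of the covariant derivative of
the vector field `Y` in the direction `v`. -/
structure IsLeviCivita (g : SemiRiemannianMetric I M)
    (cov : CovariantDerivative I E (TangentSpace I : M → Type _)) : Prop where
  torsionFree : ∀ {X Y : Π x : M, TangentSpace I x} {x : M},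
    MDiffAt (T% X) x → MDiffAt (T% Y) x →
      cov Y x (X x) - cov X x (Y x) = VectorField.mlieBracket I X Y x
  metric : ∀ {Y Z : Π x : M, TangentSpace I x} {x : M} (v : TangentSpace I x),
    MDiffAt (T% Y) x → MDiffAt (T% Z) x →
      mvfderiv I (fun y ↦ g.inner y (Y y) (Z y)) x v =
        g.inner x (cov Y x v) (Z x) + g.inner x (Y x) (cov Z x v)

/-- A connection on the tangent bundle, differentiating at each point in the preferred
trivialization at that point. It serves only as a starting point for the existence of the
Levi-Civita connection. -/
def chartConnection : CovariantDerivative I E (TangentSpace I : M → Type _) where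
  toFun σ x := (trivializationAt E (TangentSpace I) x).symmL ℝ x ∘L
    mvfderiv I (fun y ↦ (trivializationAt E (TangentSpace I : M → Type _) x ⟨y, σ y⟩).2) x
  isCovariantDerivativeOnUniv :=
    { add := by
        intro σ σ' x hσ hσ' _
        rw [mdifferentiableAt_section] at hσ hσ'
        have he : (fun y ↦ (trivializationAt E (TangentSpace I : M → Type _) x
            ⟨y, (σ + σ') y⟩).2) =ᶠ[𝓝 x]
            (fun y ↦ (trivializationAt E (TangentSpace I : M → Type _) x ⟨y, σ y⟩).2) +
            (fun y ↦ (trivializationAt E (TangentSpace I : M → Type _) x ⟨y, σ' y⟩).2) := by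
          filter_upwards [(trivializationAt E (TangentSpace I : M → Type _)
            x).open_baseSet.mem_nhds
            (mem_baseSet_trivializationAt E (TangentSpace I : M → Type _) x)] with y hy
          exact ((trivializationAt E (TangentSpace I : M → Type _) x).linear ℝ hy).map_add _ _
        rw [mvfderiv_congr_of_eventuallyEq he, mvfderiv_add hσ hσ', ContinuousLinearMap.comp_add]
      leibniz := by
        intro σ f x hσ hf _
        rw [mdifferentiableAt_section] at hσ
        have hx := mem_baseSet_trivializationAt E (TangentSpace I : M → Type _) x
        have he : (fun y ↦ (trivializationAt E (TangentSpace I : M → Type _) x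
            ⟨y, (f • σ) y⟩).2) =ᶠ[𝓝 x]
            f • (fun y ↦ (trivializationAt E (TangentSpace I : M → Type _) x ⟨y, σ y⟩).2) := by
          filter_upwards [(trivializationAt E (TangentSpace I : M → Type _)
            x).open_baseSet.mem_nhds hx] with y hy
          exact ((trivializationAt E (TangentSpace I : M → Type _) x).linear ℝ hy).map_smul _ _
        rw [mvfderiv_congr_of_eventuallyEq he, mvfderiv_smul hf hσ]
        ext v
        have hs : (trivializationAt E (TangentSpace I : M → Type _) x).symmL ℝ x
            (trivializationAt E (TangentSpace I : M → Type _) x ⟨x, σ x⟩).2 = σ x := by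
          rw [Trivialization.symmL_apply _ hx]
          exact (trivializationAt E (TangentSpace I : M → Type _) x).symm_apply_apply_mk hx (σ x)
        simp [hs] }

theorem exists_torsionFree [FiniteDimensional ℝ E] : ∃ cov : CovariantDerivative I E (TangentSpace I : M → Type _),
    ∀ {X Y : Π x : M, TangentSpace I x} {x : M},
      MDiffAt (T% X) x → MDiffAt (T% Y) x →
        cov Y x (X x) - cov X x (Y x) = VectorField.mlieBracket I X Y x := by
  have : CompleteSpace E := FiniteDimensional.complete ℝ E
  let c : CovariantDerivative I E (TangentSpace I : M → Type _) := chartConnection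
  refine ⟨c.addOneForm fun x ↦ (1 / 2 : ℝ) • c.torsion x, fun {X Y x} hX hY ↦ ?_⟩
  have h1 := c.torsion_apply hX hY
  have h2 : c.torsion x (X x) (Y x) = - c.torsion x (Y x) (X x) :=
    c.isCovariantDerivativeOn.torsion_antisymm _ _
  have h3 : VectorField.mlieBracket I X Y x
      = c Y x (X x) - c X x (Y x) - c.torsion x (X x) (Y x) := by rw [h1]; abel
  rw [h3]
  simp only [CovariantDerivative.addOneForm, add_apply, smul_apply, h2]
  module

/-- The failure of a connection to be compatible with `g`, as a function of vector fields. -/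
def derivMetricAux (g : SemiRiemannianMetric I M)
    (cov : CovariantDerivative I E (TangentSpace I : M → Type _))
    (Y Z : Π x : M, TangentSpace I x) (x : M) : TangentSpace I x →L[ℝ] ℝ :=
  mvfderiv I (fun y ↦ g.inner y (Y y) (Z y)) x
    - g.inner x (Z x) ∘L cov Y x - g.inner x (Y x) ∘L cov Z x

theorem derivMetricAux_comm (g : SemiRiemannianMetric I M)
    (cov : CovariantDerivative I E (TangentSpace I : M → Type _))
    (Y Z : Π x : M, TangentSpace I x) (x : M) :
    derivMetricAux g cov Y Z x = derivMetricAux g cov Z Y x := by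
  simp only [derivMetricAux, g.symm _ (Y _) (Z _)]
  abel

theorem derivMetricAux_tensorial (g : SemiRiemannianMetric I M)
    (cov : CovariantDerivative I E (TangentSpace I : M → Type _))
    (Z : Π x : M, TangentSpace I x) (x : M) (hZ : MDiffAt (T% Z) x) :
    TensorialAt I E (derivMetricAux g cov · Z x) x where
  smul {f σ} hf hσ := by
    have h : (fun y ↦ g.inner y ((f • σ) y) (Z y)) = f * fun y ↦ g.inner y (σ y) (Z y) := by
      ext y; simp
    ext v
    simp only [derivMetricAux, h, mvfderiv_mul hf (g.mdifferentiableAt_inner hσ hZ),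
      cov.isCovariantDerivativeOn.leibniz hσ hf]
    simp [g.symm x (Z x) (σ x)]
    ring
  add {σ σ'} hσ hσ' := by
    have h : (fun y ↦ g.inner y ((σ + σ') y) (Z y))
        = (fun y ↦ g.inner y (σ y) (Z y)) + fun y ↦ g.inner y (σ' y) (Z y) := by
      ext y; simp
    ext v
    simp only [derivMetricAux, h, mvfderiv_add (g.mdifferentiableAt_inner hσ hZ)
      (g.mdifferentiableAt_inner hσ' hZ), cov.isCovariantDerivativeOn.add hσ hσ']
    simp
    abel

theorem exists_isLeviCivita [FiniteDimensional ℝ E] (g : SemiRiemannianMetric I M) :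
    ∃ cov : CovariantDerivative I E (TangentSpace I : M → Type _), IsLeviCivita g cov := by
  obtain ⟨c, hc⟩ := exists_torsionFree (I := I) (M := M)
  have hT (Y : Π x : M, TangentSpace I x) (x : M) (hY : MDiffAt (T% Y) x) :
      TensorialAt I E (derivMetricAux g c Y · x) x := by
    simp only [derivMetricAux_comm g c Y]
    exact derivMetricAux_tensorial g c Y x hY
  let Q (x : M) : TangentSpace I x →L[ℝ] TangentSpace I x →L[ℝ] (TangentSpace I x →L[ℝ] ℝ) :=
    TensorialAt.mkHom₂ (derivMetricAux g c · · x) x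
      (fun Z hZ ↦ derivMetricAux_tensorial g c Z x hZ) (fun Y hY ↦ hT Y x hY)
  have hQ {Y Z : Π x : M, TangentSpace I x} {x : M} (hY : MDiffAt (T% Y) x)
      (hZ : MDiffAt (T% Z) x) : Q x (Y x) (Z x) = derivMetricAux g c Y Z x :=
    TensorialAt.mkHom₂_apply _ _ hY hZ
  have hQs (x : M) (u v : TangentSpace I x) : Q x u v = Q x v u := by
    simp only [Q, TensorialAt.mkHom₂_apply_eq_extend]
    exact derivMetricAux_comm _ _ _ _ _
  have (x : M) : T2Space (TangentSpace I x) := inferInstanceAs (T2Space E)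
  have (x : M) : FiniteDimensional ℝ (TangentSpace I x) :=
    inferInstanceAs (FiniteDimensional ℝ E)
  -- `g(A(u)(v), w) = (Q(u,w)(v) + Q(v,w)(u) - Q(u,v)(w)) / 2`
  have hQa (x : M) (u u' v w : TangentSpace I x) :
      Q x (u + u') v w = Q x u v w + Q x u' v w := by
    rw [(Q x).map_add]; rfl
  have hQm (x : M) (a : ℝ) (u v w : TangentSpace I x) : Q x (a • u) v w = a * Q x u v w := by
    rw [(Q x).map_smul]; rfl
  have hQa' (x : M) (u u' v w : TangentSpace I x) :
      Q x v (u + u') w = Q x v u w + Q x v u' w := by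
    rw [hQs, hQa, hQs x u, hQs x u']
  have hQm' (x : M) (a : ℝ) (u v w : TangentSpace I x) : Q x v (a • u) w = a * Q x v u w := by
    rw [hQs, hQm, hQs x u]
  have hQa'' (x : M) (u u' v w : TangentSpace I x) :
      Q x v w (u + u') = Q x v w u + Q x v w u' := (Q x v w).map_add u u'
  have hQm'' (x : M) (a : ℝ) (u v w : TangentSpace I x) : Q x v w (a • u) = a * Q x v w u :=
    (Q x v w).map_smul a u
  let q (x : M) (u v : TangentSpace I x) : TangentSpace I x →L[ℝ] ℝ :=
    LinearMap.toContinuousLinearMap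
      { toFun := fun w ↦ (1 / 2 : ℝ) * (Q x u w v + Q x v w u - Q x u v w)
        map_add' := by intros; simp; ring
        map_smul' := by intros; simp; ring }
  have hq (x : M) (u v w : TangentSpace I x) :
      q x u v w = (1 / 2 : ℝ) * (Q x u w v + Q x v w u - Q x u v w) := rfl
  let A (x : M) : TangentSpace I x →L[ℝ] TangentSpace I x →L[ℝ] TangentSpace I x :=
    (LinearMap.mk₂ ℝ (fun u v ↦ g.sharp x (q x u v))
      (by intros; rw [← map_add]; congr 1; ext w; simp only [hq, add_apply, hQa, hQa'']; ring)
      (by intros; rw [← map_smul]; congr 1; ext w; simp only [hq, smul_apply, smul_eq_mul, hQm, hQm'']; ring)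
      (by intros; rw [← map_add]; congr 1; ext w; simp only [hq, add_apply, hQa, hQa', hQa'']; ring)
      (by intros; rw [← map_smul]; congr 1; ext w; simp only [hq, smul_apply, smul_eq_mul, hQm, hQm', hQm'']; ring)).toContinuousBilinearMap
  have hA (x : M) (u v w : TangentSpace I x) : g.inner x (A x u v) w =
      (1 / 2 : ℝ) * (Q x u w v + Q x v w u - Q x u v w) := by
    have : A x u v = g.sharp x (q x u v) := rfl
    rw [this, g.inner_sharp, hq]
  have hAs (x : M) (u v : TangentSpace I x) : A x u v = A x v u := by
    rw [← sub_eq_zero]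
    refine g.nondegenerate x _ fun w ↦ ?_
    simp only [map_sub, sub_apply, hA, hQs x u v]
    ring
  refine ⟨c.addOneForm A, ⟨fun {X Y x} hX hY ↦ ?_, fun {Y Z x} v hY hZ ↦ ?_⟩⟩
  · rw [← hc hX hY]
    simp only [CovariantDerivative.addOneForm, add_apply, hAs x (Y x) (X x)]
    abel
  · have h := congr($(hQ hY hZ) v)
    simp only [derivMetricAux, sub_apply, ContinuousLinearMap.comp_apply] at h
    simp only [CovariantDerivative.addOneForm, add_apply, map_add, g.symm x (Y x),
      hA, hQs x (Z x) (Y x), hQs x v (Y x), hQs x v (Z x)]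
    rw [g.symm x (Z x), g.symm x (Y x)] at h
    linarith

/-- The Levi-Civita connection of a semi-Riemannian metric. -/
def leviCivita [FiniteDimensional ℝ E] (g : SemiRiemannianMetric I M) :
    CovariantDerivative I E (TangentSpace I : M → Type _) :=
  (exists_isLeviCivita g).choose

theorem isLeviCivita_leviCivita [FiniteDimensional ℝ E] (g : SemiRiemannianMetric I M) :
    IsLeviCivita g (leviCivita g) :=
  (exists_isLeviCivita g).choose_spec

/-- The Levi-Civita connection is unique (on differentiable vector fields). -/
theorem IsLeviCivita.eq [FiniteDimensional ℝ E] {g : SemiRiemannianMetric I M}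
    {cov cov' : CovariantDerivative I E (TangentSpace I : M → Type _)}
    (h : IsLeviCivita g cov) (h' : IsLeviCivita g cov') {Y : Π x : M, TangentSpace I x} {x : M}
    (hY : MDiffAt (T% Y) x) : cov Y x = cov' Y x := by
  have : CompleteSpace E := FiniteDimensional.complete ℝ E
  -- `D(u, v) = (∇ - ∇')_v u` is symmetric, and `g(D(u, v), w)` is skew in `u, w`
  let D : ∀ x : M, TangentSpace I x →L[ℝ] TangentSpace I x →L[ℝ] TangentSpace I x :=
    cov.difference cov'
  have hD {Y : Π x : M, TangentSpace I x} {x : M} (hY : MDiffAt (T% Y) x) :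
      D x (Y x) = cov Y x - cov' Y x :=
    IsCovariantDerivativeOn.difference_apply _ _ (by trivial) hY
  have hex (u : TangentSpace I x) : ∃ U : Π x : M, TangentSpace I x, MDiffAt (T% U) x ∧ U x = u :=
    ⟨FiberBundle.extend E u, FiberBundle.mdifferentiableAt_extend .., by simp⟩
  have hs (u v : TangentSpace I x) : D x u v = D x v u := by
    obtain ⟨U, hU, rfl⟩ := hex u
    obtain ⟨V, hV, rfl⟩ := hex v
    have h1 := h.torsionFree hU hV
    have h2 := h'.torsionFree hU hV
    rw [hD hU, hD hV, sub_apply, sub_apply]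
    have h3 := h1.trans h2.symm
    rw [sub_eq_sub_iff_add_eq_add] at h3 ⊢
    rw [add_comm, ← h3, add_comm]
  have hk (u v w : TangentSpace I x) :
      g.inner x (D x u v) w + g.inner x (D x w v) u = 0 := by
    obtain ⟨U, hU, rfl⟩ := hex u
    obtain ⟨W, hW, rfl⟩ := hex w
    have h1 := h.metric v hU hW
    have h2 := h'.metric v hU hW
    rw [hD hU, hD hW, sub_apply, sub_apply, map_sub, map_sub, sub_apply, sub_apply]
    rw [g.symm x (U x)] at h1 h2
    linarith
  ext v
  rw [← sub_eq_zero, ← sub_apply, ← hD hY]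
  refine g.nondegenerate x _ fun w ↦ ?_
  have e1 := hk (Y x) v w
  have e2 := hk w (Y x) v
  have e3 := hk v w (Y x)
  rw [hs w (Y x)] at e2
  rw [hs w v] at e1
  rw [hs v (Y x)] at e2
  linarith


/-! ### The Hessian -/

theorem mdifferentiableAt_mvfderiv {f : M → ℝ} (hf : ContMDiff I 𝓘(ℝ, ℝ) ∞ f)
    {Y : Π x : M, TangentSpace I x} {x : M} (hY : MDiffAt (T% Y) x) :
    MDiffAt (fun y ↦ mvfderiv I f y (Y y)) x := by
  have h1 : MDifferentiableAt I.tangent 𝓘(ℝ, ℝ).tangent (tangentMap I 𝓘(ℝ, ℝ) f) ⟨x, Y x⟩ :=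
    ((hf.contMDiff_tangentMap (m := 1) (by norm_cast)).contMDiffAt).mdifferentiableAt
      (by simp)
  have h2 := h1.comp x hY
  have h3 := ((mdifferentiableAt_totalSpace 𝓘(ℝ, ℝ) (F := ℝ)
    (E := (TangentSpace 𝓘(ℝ, ℝ) : ℝ → Type _)) _).1 h2).2
  exact h3.congr_of_eventuallyEq (Eventually.of_forall fun y ↦ by
    simp only [tangentMap, Function.comp_apply]
    erw [_root_.trivializationAt_model_space_apply]
    rfl)

/-- `Y ↦ X (Y f) - (∇_X Y) f`, at the point `x`, as a linear form in `X`. -/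
def hessianAux (g : SemiRiemannianMetric I M) [FiniteDimensional ℝ E] (f : M → ℝ)
    (Y : Π x : M, TangentSpace I x) (x : M) : TangentSpace I x →L[ℝ] ℝ :=
  mvfderiv I (fun y ↦ mvfderiv I f y (Y y)) x - mvfderiv I f x ∘L leviCivita g Y x

theorem hessianAux_tensorial [FiniteDimensional ℝ E] (g : SemiRiemannianMetric I M) {f : M → ℝ}
    (hf : ContMDiff I 𝓘(ℝ, ℝ) ∞ f) (x : M) :
    TensorialAt I E (hessianAux g f · x) x where
  smul {a σ} ha hσ := by
    have h : (fun y ↦ mvfderiv I f y ((a • σ) y)) = a * fun y ↦ mvfderiv I f y (σ y) := by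
      ext y; simp
    ext v
    simp only [hessianAux, h, mvfderiv_mul ha (mdifferentiableAt_mvfderiv hf hσ),
      (leviCivita g).isCovariantDerivativeOn.leibniz hσ ha]
    simp
    ring
  add {σ σ'} hσ hσ' := by
    have h : (fun y ↦ mvfderiv I f y ((σ + σ') y))
        = (fun y ↦ mvfderiv I f y (σ y)) + fun y ↦ mvfderiv I f y (σ' y) := by
      ext y; simp
    ext v
    simp only [hessianAux, h, mvfderiv_add (mdifferentiableAt_mvfderiv hf hσ)
      (mdifferentiableAt_mvfderiv hf hσ'), (leviCivita g).isCovariantDerivativeOn.add hσ hσ']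
    simp
    abel

/-- The Hessian of a smooth function on a semi-Riemannian manifold: the `(0,2)`-tensor field
`Hess f (X, Y) = X (Y f) - (∇_X Y) f`, with `∇` the Levi-Civita connection. -/
def hessian [FiniteDimensional ℝ E] (g : SemiRiemannianMetric I M) (f : C^∞⟮I, M; ℝ⟯) (x : M)
    (u v : TangentSpace I x) : ℝ :=
  TensorialAt.mkHom (hessianAux g f · x) x (hessianAux_tensorial g f.contMDiff x) v u

theorem hessian_apply [FiniteDimensional ℝ E] (g : SemiRiemannianMetric I M) (f : C^∞⟮I, M; ℝ⟯)
    (x : M) (u : TangentSpace I x) {Y : Π x : M, TangentSpace I x} (hY : MDiffAt (T% Y) x) :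
    hessian g f x u (Y x) =
      mvfderiv I (fun y ↦ mvfderiv I f y (Y y)) x u - mvfderiv I f x (leviCivita g Y x u) := by
  rw [hessian, TensorialAt.mkHom_apply _ hY]
  rfl

/-! ### Differentiation along a submanifold and the second fundamental form -/

open Classical in
/-- The derivative `∇_v Y` at `q ∈ S`, in the direction of a vector `v` tangent to a submanifold
`S`, of a vector field `Y` along `S`: it is `∇_v Z` for a local smooth extension `Z` of `Y` to the
ambient manifold (and `0` by convention if there is no such extension). Only the values of `Y` on
`S` matter. -/
def covDerivAlong (cov : CovariantDerivative I E (TangentSpace I : M → Type _)) (S : Set M)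
    (Y : Π x : M, TangentSpace I x) (q : M) (v : TangentSpace I q) : TangentSpace I q :=
  if h : ∃ Z : Π x : M, TangentSpace I x,
      ContMDiffAt I I.tangent ∞ (fun x ↦ (⟨x, Z x⟩ : TangentBundle I M)) q ∧
        ∀ᶠ x in 𝓝[S] q, Z x = Y x
  then cov h.choose q v else 0

/-- The second fundamental form `B_ξ(X, Y) = g(∇_X Y, ξ)` of a submanifold `S` with respect to a
normal field `ξ`, where `∇` is the Levi-Civita connection of the ambient metric `g`. -/
def secondFundamentalForm [FiniteDimensional ℝ E] (g : SemiRiemannianMetric I M) (S : Set M)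
    (ξ X Y : Π x : M, TangentSpace I x) (q : M) : ℝ :=
  g.inner q (covDerivAlong (leviCivita g) S Y q (X q)) (ξ q)

end LeviCivita

/-! ### The ambient space `ℝ × M` with the metric `-dx⁰ ⊗ dx⁰ + π^* g` -/

section Pullback

variable {E : Type*} [NormedAddCommGroup E] [NormedSpace ℝ E]
  {H : Type*} [TopologicalSpace H] {I : ModelWithCorners ℝ E H}
  {M : Type*} [TopologicalSpace M] [ChartedSpace H M]
  {E' : Type*} [NormedAddCommGroup E'] [NormedSpace ℝ E']
  {H' : Type*} [TopologicalSpace H'] {I' : ModelWithCorners ℝ E' H'}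
  {N : Type*} [TopologicalSpace N] [ChartedSpace H' N]

/-- The pullback `f^* h` of a `(0,2)`-tensor field: `(f^* h)(v, w) = h(df v, df w)`. -/
def pullbackTensor (f : M → N)
    (h : ∀ y : N, TangentSpace I' y →L[ℝ] TangentSpace I' y →L[ℝ] ℝ) (x : M) :
    TangentSpace I x →L[ℝ] TangentSpace I x →L[ℝ] ℝ :=
  (ContinuousLinearMap.precomp ℝ (mfderiv I I' f x)) ∘L (h (f x)) ∘L (mfderiv I I' f x)

theorem contMDiff_pullbackTensor [IsManifold I ∞ M] [IsManifold I' ∞ N] {f : M → N}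
    (hf : ContMDiff I I' ∞ f)
    {h : ∀ y : N, TangentSpace I' y →L[ℝ] TangentSpace I' y →L[ℝ] ℝ}
    (hh : ContMDiff I' (I'.prod 𝓘(ℝ, E' →L[ℝ] E' →L[ℝ] ℝ)) ∞
      (fun y ↦ TotalSpace.mk' (E' →L[ℝ] E' →L[ℝ] ℝ) y (h y))) :
    ContMDiff I (I.prod 𝓘(ℝ, E →L[ℝ] E →L[ℝ] ℝ)) ∞
      (fun x ↦ TotalSpace.mk' (E →L[ℝ] E →L[ℝ] ℝ) x (pullbackTensor (I := I) f h x)) := by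
  intro x₀
  rw [contMDiffAt_hom_bundle]
  refine ⟨contMDiffAt_id, ?_⟩
  have hJ := (hf x₀).mfderiv_const (m := ∞) (by simp)
  have hG := ((contMDiffAt_hom_bundle _).1 (hh (f x₀))).2.comp x₀ (hf x₀)
  have key := (hJ.clm_precomp (F₃ := ℝ)).clm_comp (hG.clm_comp hJ)
  refine key.congr_of_eventuallyEq ?_
  filter_upwards [(trivializationAt E (TangentSpace I) x₀).open_baseSet.mem_nhds
    (mem_baseSet_trivializationAt E (TangentSpace I) x₀),
    (hf x₀).continuousAt.preimage_mem_nhds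
    ((trivializationAt E' (TangentSpace I') (f x₀)).open_baseSet.mem_nhds
    (mem_baseSet_trivializationAt E' (TangentSpace I') (f x₀)))] with x hx hx'
  have hx2 : f x ∈ (trivializationAt E' (TangentSpace I') (f x₀)).baseSet := hx'
  have hs (u : TangentSpace I' (f x)) :
      (trivializationAt E' (TangentSpace I') (f x₀)).symm (f x)
        (trivializationAt E' (TangentSpace I' : N → Type _) (f x₀) ⟨f x, u⟩).2 = u :=
    (trivializationAt E' (TangentSpace I' : N → Type _) (f x₀)).symm_apply_apply_mk hx2 u
  ext v w
  rw [inCoordinates_apply_eq₂ hx hx (Set.mem_univ _)]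
  simp only [pullbackTensor, ContinuousLinearMap.comp_apply, ContinuousLinearMap.precomp_apply,
    Function.comp_apply]
  rw [inCoordinates_apply_eq₂ hx2 hx2 (Set.mem_univ _)]
  simp [inTangentCoordinates, ContinuousLinearMap.inCoordinates_eq hx hx2, hs]

theorem contMDiff_neg_add_tensor [IsManifold I ∞ M]
    {h h' : ∀ x : M, TangentSpace I x →L[ℝ] TangentSpace I x →L[ℝ] ℝ}
    (hh : ContMDiff I (I.prod 𝓘(ℝ, E →L[ℝ] E →L[ℝ] ℝ)) ∞
      (fun x ↦ TotalSpace.mk' (E →L[ℝ] E →L[ℝ] ℝ) x (h x)))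
    (hh' : ContMDiff I (I.prod 𝓘(ℝ, E →L[ℝ] E →L[ℝ] ℝ)) ∞
      (fun x ↦ TotalSpace.mk' (E →L[ℝ] E →L[ℝ] ℝ) x (h' x))) :
    ContMDiff I (I.prod 𝓘(ℝ, E →L[ℝ] E →L[ℝ] ℝ)) ∞
      (fun x ↦ TotalSpace.mk' (E →L[ℝ] E →L[ℝ] ℝ) x (-h x + h' x)) :=
  have (x : M) : IsTopologicalAddGroup (TangentSpace I x →L[ℝ] ℝ) :=
    inferInstanceAs (IsTopologicalAddGroup (E →L[ℝ] ℝ))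
  have (x : M) : IsTopologicalAddGroup (TangentSpace I x →L[ℝ] TangentSpace I x →L[ℝ] ℝ) :=
    inferInstanceAs (IsTopologicalAddGroup (E →L[ℝ] E →L[ℝ] ℝ))
  (hh.neg_section (V := fun x ↦ TangentSpace I x →L[ℝ] TangentSpace I x →L[ℝ] ℝ)).add_section
    (V := fun x ↦ TangentSpace I x →L[ℝ] TangentSpace I x →L[ℝ] ℝ) hh'

end Pullback

section Monge

variable {E : Type*} [NormedAddCommGroup E] [NormedSpace ℝ E]
  {H : Type*} [TopologicalSpace H] {I : ModelWithCorners ℝ E H}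
  {M : Type*} [TopologicalSpace M] [ChartedSpace H M] [IsManifold I ∞ M]

/-- The tensor field `dt ⊗ dt` on `ℝ`. -/
def dtSq (t : ℝ) : TangentSpace 𝓘(ℝ, ℝ) t →L[ℝ] TangentSpace 𝓘(ℝ, ℝ) t →L[ℝ] ℝ :=
  ContinuousLinearMap.mul ℝ ℝ

/-- The bilinear form `-dx⁰ ⊗ dx⁰ + π^* g` on `T_q (ℝ × M)`. -/
def ambientInner (g : SemiRiemannianMetric I M) (q : ℝ × M) :
    TangentSpace (𝓘(ℝ, ℝ).prod I) q →L[ℝ] TangentSpace (𝓘(ℝ, ℝ).prod I) q →L[ℝ] ℝ :=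
  -pullbackTensor Prod.fst dtSq q + pullbackTensor Prod.snd g.inner q

theorem ambientInner_apply (g : SemiRiemannianMetric I M) (q : ℝ × M)
    (v w : TangentSpace (𝓘(ℝ, ℝ).prod I) q) :
    ambientInner g q v w =
      -(mvfderiv (𝓘(ℝ, ℝ).prod I) (Prod.fst : ℝ × M → ℝ) q v *
          mvfderiv (𝓘(ℝ, ℝ).prod I) (Prod.fst : ℝ × M → ℝ) q w) +
        g.inner q.2 (mfderiv (𝓘(ℝ, ℝ).prod I) I (Prod.snd : ℝ × M → M) q v)
          (mfderiv (𝓘(ℝ, ℝ).prod I) I (Prod.snd : ℝ × M → M) q w) :=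
  rfl

/-- The same formula in terms of the components of `T_q (ℝ × M) = ℝ × T_p M`. -/
theorem ambientInner_apply' (g : SemiRiemannianMetric I M) (q : ℝ × M) (v w : ℝ × E) :
    (ambientInner g q : ℝ × E →L[ℝ] ℝ × E →L[ℝ] ℝ) v w =
      -(v.1 * w.1) + (g.inner q.2 : E →L[ℝ] E →L[ℝ] ℝ) v.2 w.2 := by
  have h1 (u : ℝ × E) : mvfderiv (𝓘(ℝ, ℝ).prod I) (Prod.fst : ℝ × M → ℝ) q u = u.1 := by
    simp only [mvfderiv, mfderiv_fst]
    rfl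
  have h2 (u : ℝ × E) : mfderiv (𝓘(ℝ, ℝ).prod I) I (Prod.snd : ℝ × M → M) q u = u.2 := by
    simp only [mfderiv_snd]
    rfl
  have h := ambientInner_apply g q v w
  simp only [h1] at h
  refine h.trans ?_
  congr 1
  exact congr(g.inner q.2 $(h2 v) $(h2 w))

theorem contMDiff_ambientInner (g : SemiRiemannianMetric I M) :
    ContMDiff (𝓘(ℝ, ℝ).prod I) ((𝓘(ℝ, ℝ).prod I).prod 𝓘(ℝ, ℝ × E →L[ℝ] ℝ × E →L[ℝ] ℝ)) ∞
      (fun q ↦ TotalSpace.mk' (ℝ × E →L[ℝ] ℝ × E →L[ℝ] ℝ) q (ambientInner g q)) := by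
  have h1 : ContMDiff 𝓘(ℝ, ℝ) (𝓘(ℝ, ℝ).prod 𝓘(ℝ, ℝ →L[ℝ] ℝ →L[ℝ] ℝ)) ∞
      (fun t : ℝ ↦ TotalSpace.mk' (ℝ →L[ℝ] ℝ →L[ℝ] ℝ)
        (E := fun t : ℝ ↦ TangentSpace 𝓘(ℝ, ℝ) t →L[ℝ] TangentSpace 𝓘(ℝ, ℝ) t →L[ℝ] ℝ)
        t (dtSq t)) := by
    intro t
    rw [contMDiffAt_hom_bundle]
    refine ⟨contMDiffAt_id, ?_⟩
    refine (contMDiffAt_const (c := ContinuousLinearMap.mul ℝ ℝ)).congr_of_eventuallyEq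
      (Eventually.of_forall fun s ↦ ?_)
    have hs : s ∈ (trivializationAt ℝ (TangentSpace 𝓘(ℝ, ℝ) : ℝ → Type _) t).baseSet :=
      Set.mem_univ s
    have hsymm (v : ℝ) :
        (trivializationAt ℝ (TangentSpace 𝓘(ℝ, ℝ) : ℝ → Type _) t).symm s v = v := by
      have := (trivializationAt ℝ (TangentSpace 𝓘(ℝ, ℝ) : ℝ → Type _) t).symm_apply_apply_mk hs v
      rwa [trivializationAt_model_space_apply] at this
    ext
    simp only
    rw [inCoordinates_apply_eq₂ hs hs (Set.mem_univ _), hsymm]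
    simp [dtSq]
    exact mul_one (1 : ℝ)
  have h2 := contMDiff_pullbackTensor (I := 𝓘(ℝ, ℝ).prod I) (M := ℝ × M) contMDiff_fst h1
  have h3 := contMDiff_pullbackTensor (I := 𝓘(ℝ, ℝ).prod I) (M := ℝ × M) contMDiff_snd g.contMDiff
  exact contMDiff_neg_add_tensor h2 h3

/-- The ambient semi-Riemannian metric `-dx⁰ ⊗ dx⁰ + π^* g` on `ℝ × M`. -/
def ambientMetric (g : SemiRiemannianMetric I M) :
    SemiRiemannianMetric (𝓘(ℝ, ℝ).prod I) (ℝ × M) where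
  inner := ambientInner g
  symm q v w := by
    rw [ambientInner_apply, ambientInner_apply, g.symm, mul_comm]
  nondegenerate q v h := by
    have h' (w : ℝ × E) := (ambientInner_apply' g q v w).symm.trans (h w)
    have h1 : (v : ℝ × E).1 = 0 := by
      have := h' (1, 0)
      rw [show (g.inner q.2 : E →L[ℝ] E →L[ℝ] ℝ) (v : ℝ × E).2 ((1 : ℝ), (0 : E)).2 = 0 from
        (g.inner q.2 (v : ℝ × E).2).map_zero] at this
      simpa using this
    have h2 : (v : ℝ × E).2 = 0 := g.nondegenerate q.2 _ fun u ↦ by simpa using! h' (0, u)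
    exact Prod.ext h1 h2
  contMDiff := contMDiff_ambientInner g

/-- The hypersurface `{(t, p) | t = f p}` of `ℝ × M`. -/
def mongeHypersurface (f : M → ℝ) : Set (ℝ × M) := {q | q.1 = f q.2}

/-- The tangent space of the hypersurface `{(t, p) | t = f p}` at one of its points `q`: the image
of the differential of its parametrization `p ↦ (f p, p)`, seen in `T_q (ℝ × M)`. -/
def mongeTangentSpace (f : M → ℝ) (q : ℝ × M) : Set (TangentSpace (𝓘(ℝ, ℝ).prod I) q) :=
  Set.range (mfderiv I (𝓘(ℝ, ℝ).prod I) (fun p : M ↦ (f p, p)) q.2 :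
    TangentSpace I q.2 → TangentSpace (𝓘(ℝ, ℝ).prod I) q)

/-- `X` restricts to a smooth tangent vector field on the hypersurface `{(t, p) | t = f p}`. The
values of `X` off the hypersurface are irrelevant. -/
structure IsTangentFieldOnMonge (f : M → ℝ)
    (X : Π q : ℝ × M, TangentSpace (𝓘(ℝ, ℝ).prod I) q) : Prop where
  tangent : ∀ q ∈ mongeHypersurface f, X q ∈ mongeTangentSpace (I := I) f q
  contMDiffOn : ContMDiffOn (𝓘(ℝ, ℝ).prod I) (𝓘(ℝ, ℝ).prod I).tangent ∞
    (fun q ↦ (⟨q, X q⟩ : TangentBundle (𝓘(ℝ, ℝ).prod I) (ℝ × M))) (mongeHypersurface f)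

/-- The coordinate field `∂/∂x⁰` on `ℝ × M`. -/
def partialZero (q : ℝ × M) : TangentSpace (𝓘(ℝ, ℝ).prod I) q :=
  ((1 : ℝ), (0 : E))

/-- The lift `X_L` to `ℝ × M` of a vector field `X` on `M`: the field that projects to `0` on `ℝ`
and to `X` on `M`. -/
def liftField (X : Π p : M, TangentSpace I p) (q : ℝ × M) : TangentSpace (𝓘(ℝ, ℝ).prod I) q :=
  ((0 : ℝ), (X q.2 : E))

/-- The normal field `ξ = ∂/∂x⁰ + (grad f)_L`. -/
def mongeNormal [FiniteDimensional ℝ E] (g : SemiRiemannianMetric I M) (f : M → ℝ) (q : ℝ × M) :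
    TangentSpace (𝓘(ℝ, ℝ).prod I) q :=
  partialZero q + liftField (g.grad f) q

end Monge

end

noncomputable section

section Koszul

variable {E : Type*} [NormedAddCommGroup E] [NormedSpace ℝ E]
  {H : Type*} [TopologicalSpace H] {I : ModelWithCorners ℝ E H}
  {M : Type*} [TopologicalSpace M] [ChartedSpace H M] [IsManifold I ∞ M]

/-- The Koszul formula. -/
theorem IsLeviCivita.koszul {g : SemiRiemannianMetric I M}
    {cov : CovariantDerivative I E (TangentSpace I : M → Type _)} (h : IsLeviCivita g cov)
    {X Y Z : Π x : M, TangentSpace I x} {x : M}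
    (hX : MDiffAt (T% X) x) (hY : MDiffAt (T% Y) x) (hZ : MDiffAt (T% Z) x) :
    2 * g.inner x (cov Y x (X x)) (Z x) =
      mvfderiv I (fun y ↦ g.inner y (Y y) (Z y)) x (X x)
        + mvfderiv I (fun y ↦ g.inner y (X y) (Z y)) x (Y x)
        - mvfderiv I (fun y ↦ g.inner y (X y) (Y y)) x (Z x)
        + g.inner x (VectorField.mlieBracket I X Y x) (Z x)
        - g.inner x (VectorField.mlieBracket I X Z x) (Y x)
        - g.inner x (VectorField.mlieBracket I Y Z x) (X x) := by
  rw [h.metric _ hY hZ, h.metric _ hX hZ, h.metric _ hX hY, ← h.torsionFree hX hY,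
    ← h.torsionFree hX hZ, ← h.torsionFree hY hZ]
  simp only [map_sub, sub_apply]
  rw [g.symm x (Y x) (cov Z x (X x)), g.symm x (X x) (cov Z x (Y x)),
    g.symm x (X x) (cov Y x (Z x))]
  ring

end Koszul

section ProdField

variable {E : Type*} [NormedAddCommGroup E] [NormedSpace ℝ E]
  {H : Type*} [TopologicalSpace H] {I : ModelWithCorners ℝ E H}
  {M : Type*} [TopologicalSpace M] [ChartedSpace H M]

/-- The vector field `c ∂/∂x⁰ + V_L` on `ℝ × M`. -/
def prodField (c : ℝ) (V : Π p : M, TangentSpace I p) (q : ℝ × M) :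
    TangentSpace (𝓘(ℝ, ℝ).prod I) q :=
  (c, (V q.2 : E))

theorem contMDiffAt_tangentBundle_modelSpace {F : Type*} [NormedAddCommGroup F]
    [NormedSpace ℝ F] {n : WithTop ℕ∞} {f s : M → F} {x : M}
    (hf : ContMDiffAt I 𝓘(ℝ, F) n f x) (hs : ContMDiffAt I 𝓘(ℝ, F) n s x) :
    ContMDiffAt I 𝓘(ℝ, F).tangent n (fun y ↦ (⟨f y, s y⟩ : TangentBundle 𝓘(ℝ, F) F)) x := by
  refine (contMDiffAt_totalSpace (F := F) (E := (TangentSpace 𝓘(ℝ, F) : F → Type _))).2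
    ⟨hf, ?_⟩
  refine hs.congr_of_eventuallyEq (Eventually.of_forall fun y ↦ ?_)
  simp

theorem mdifferentiableAt_prodField [IsManifold I 1 M] (c : ℝ) {V : Π p : M, TangentSpace I p}
    {q : ℝ × M} (hV : MDiffAt (T% V) q.2) : MDiffAt (T% (prodField c V)) q := by
  have h1 : MDifferentiableAt 𝓘(ℝ, ℝ) 𝓘(ℝ, ℝ).tangent
      (fun t : ℝ ↦ (⟨t, c⟩ : TangentBundle 𝓘(ℝ, ℝ) ℝ)) q.1 :=
    (contMDiffAt_tangentBundle_modelSpace (n := 1) contMDiffAt_id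
      contMDiffAt_const).mdifferentiableAt one_ne_zero
  exact ((contMDiff_equivTangentBundleProd_symm (n := 1)).contMDiffAt.mdifferentiableAt
    one_ne_zero).comp q ((h1.comp q mdifferentiableAt_fst).prodMk (hV.comp q mdifferentiableAt_snd))

theorem mfderivWithin_extChartAt_symm_real_prod [IsManifold I 1 M] (q : ℝ × M) {y : ℝ × E}
    (hy : y.2 ∈ (extChartAt I q.2).target) (v : ℝ × E) :
    (mfderivWithin 𝓘(ℝ, ℝ × E) (𝓘(ℝ, ℝ).prod I) (extChartAt (𝓘(ℝ, ℝ).prod I) q).symm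
        (Set.range (𝓘(ℝ, ℝ).prod I)) y v : ℝ × E) =
      (v.1, (mfderivWithin 𝓘(ℝ, E) I (extChartAt I q.2).symm (Set.range I) y.2 v.2 : E)) := by
  have hr : Set.range (𝓘(ℝ, ℝ).prod I) = (Set.univ : Set ℝ) ×ˢ Set.range I := by
    rw [modelWithCorners_prod_coe, Set.range_prodMap]; simp
  have hu : UniqueMDiffWithinAt 𝓘(ℝ, E) (Set.range I) y.2 :=
    I.uniqueMDiffOn _ (extChartAt_target_subset_range q.2 hy)
  have := mfderivWithin_prodMap (p := y) (I := 𝓘(ℝ, ℝ)) (I' := 𝓘(ℝ, E)) (s := Set.univ)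
    (t := Set.range I) (f := (id : ℝ → ℝ)) (g := (extChartAt I q.2).symm)
    mdifferentiableWithinAt_id (mdifferentiableWithinAt_extChartAt_symm hy)
    (uniqueMDiffWithinAt_univ _) hu
  rw [← modelWithCornersSelf_prod, chartedSpaceSelf_prod] at this
  rw [hr, extChartAt_prod, extChartAt_model_space_eq_id]
  refine (congr($this v)).trans ?_
  refine Prod.ext ?_ rfl
  exact congr($(mfderivWithin_id (uniqueMDiffWithinAt_univ 𝓘(ℝ, ℝ))) v.1)

theorem mfderiv_extChartAt_real_prod [IsManifold I 1 M] (q : ℝ × M) (v : ℝ × E) :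
    (mfderiv (𝓘(ℝ, ℝ).prod I) 𝓘(ℝ, ℝ × E) (extChartAt (𝓘(ℝ, ℝ).prod I) q) q v : ℝ × E) =
      (v.1, (mfderiv I 𝓘(ℝ, E) (extChartAt I q.2) q.2 v.2 : E)) := by
  have := mfderiv_prodMap (p := q) (I := 𝓘(ℝ, ℝ)) (J := 𝓘(ℝ, ℝ)) (I' := I) (J' := 𝓘(ℝ, E))
    (f := (id : ℝ → ℝ)) (g := extChartAt I q.2)
    mdifferentiableAt_id (mdifferentiableAt_extChartAt (mem_chart_source H q.2))
  rw [← modelWithCornersSelf_prod, chartedSpaceSelf_prod] at this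
  rw [extChartAt_prod, extChartAt_model_space_eq_id]
  refine (congr($this v)).trans ?_
  refine Prod.ext ?_ rfl
  exact congr($(mfderiv_id (I := 𝓘(ℝ, ℝ)) (x := q.1)) v.1)

theorem mpullbackWithin_extChartAt_symm_prodField [IsManifold I 1 M] (c : ℝ)
    (V : Π p : M, TangentSpace I p) (q : ℝ × M) {y : ℝ × E}
    (hy : y.2 ∈ (extChartAt I q.2).target) :
    (VectorField.mpullbackWithin 𝓘(ℝ, ℝ × E) (𝓘(ℝ, ℝ).prod I)
        (extChartAt (𝓘(ℝ, ℝ).prod I) q).symm (prodField c V)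
        (Set.range (𝓘(ℝ, ℝ).prod I)) y : ℝ × E) =
      (c, (VectorField.mpullbackWithin 𝓘(ℝ, E) I (extChartAt I q.2).symm V
        (Set.range I) y.2 : E)) := by
  have hy' : y ∈ (extChartAt (𝓘(ℝ, ℝ).prod I) q).target := by
    rw [extChartAt_prod]; exact ⟨by simp only [extChartAt_model_space_eq_id]; trivial, hy⟩
  have h1 := isInvertible_mfderivWithin_extChartAt_symm (I := 𝓘(ℝ, ℝ).prod I) hy'
  have h2 := isInvertible_mfderivWithin_extChartAt_symm hy
  rw [VectorField.mpullbackWithin_apply, VectorField.mpullbackWithin_apply]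
  refine (h1.inverse_apply_eq).2 ?_
  refine Eq.trans ?_ (mfderivWithin_extChartAt_symm_real_prod q hy _).symm
  refine Prod.ext rfl ?_
  exact ((h2.inverse_apply_eq).1 rfl)

theorem mlieBracket_prodField [IsManifold I 2 M] [CompleteSpace E] (c d : ℝ)
    {U V : Π p : M, TangentSpace I p}
    {q : ℝ × M} (hU : MDiffAt (T% U) q.2) (hV : MDiffAt (T% V) q.2) :
    VectorField.mlieBracket (𝓘(ℝ, ℝ).prod I) (prodField c U) (prodField d V) q =
      prodField 0 (VectorField.mlieBracket I U V) q := by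
  have : IsManifold I 1 M := .of_le (n := 2) (by norm_num)
  have hr : Set.range (𝓘(ℝ, ℝ).prod I) = (Set.univ : Set ℝ) ×ˢ Set.range I := by
    rw [modelWithCorners_prod_coe, Set.range_prodMap]; simp
  have hm : extChartAt I q.2 q.2 ∈ Set.range I :=
    extChartAt_target_subset_range q.2 (mem_extChartAt_target q.2)
  have hud : UniqueDiffWithinAt ℝ (Set.range I) (extChartAt I q.2 q.2) := I.uniqueDiffOn _ hm
  have key (a b : ℝ) {W : Π p : M, TangentSpace I p} (hW : MDiffAt (T% W) q.2) (v : E) :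
      fderivWithin ℝ (fun y : ℝ × E ↦ (a, (VectorField.mpullbackWithin 𝓘(ℝ, E) I
          (extChartAt I q.2).symm W (Set.range I) y.2 : E)))
        ((Set.univ : Set ℝ) ×ˢ Set.range I) (q.1, extChartAt I q.2 q.2) (b, v) =
      (0, fderivWithin ℝ (VectorField.mpullbackWithin 𝓘(ℝ, E) I
          (extChartAt I q.2).symm W (Set.range I) : E → E) (Set.range I)
          (extChartAt I q.2 q.2) v) := by
    have h1 := MDifferentiableWithinAt.differentiableWithinAt_mpullbackWithin_vectorField
      (s := Set.univ) (V := W) hW.mdifferentiableWithinAt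
    rw [Set.preimage_univ, Set.univ_inter] at h1
    have h2 := h1.hasFDerivWithinAt.comp (q.1, extChartAt I q.2 q.2)
      (hasFDerivWithinAt_snd (𝕜 := ℝ) (s := (Set.univ : Set ℝ) ×ˢ Set.range I))
      (fun y hy ↦ hy.2)
    have h3 := (hasFDerivWithinAt_const (𝕜 := ℝ) a (q.1, extChartAt I q.2 q.2)
      ((Set.univ : Set ℝ) ×ˢ Set.range I)).prodMk h2
    have h4 := h3.fderivWithin (uniqueDiffWithinAt_univ.prod hud)
    exact congr($h4 (b, v))
  have hq : q ∈ (extChartAt (𝓘(ℝ, ℝ).prod I) q).source := mem_extChartAt_source q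
  have hp : q.2 ∈ (extChartAt I q.2).source := mem_extChartAt_source q.2
  rw [← VectorField.mlieBracketWithin_univ, ← VectorField.mlieBracketWithin_univ]
  have hB := ((isInvertible_mfderiv_extChartAt hp).inverse_apply_eq).1
    (VectorField.mlieBracketWithin_apply (I := I) (V := U) (W := V) (s := Set.univ)
      (x₀ := q.2)).symm
  refine ((isInvertible_mfderiv_extChartAt hq).inverse_apply_eq).2 ?_
  refine Eq.trans ?_ (mfderiv_extChartAt_real_prod q _).symm
  rw [Set.preimage_univ, Set.univ_inter] at hB
  refine Eq.trans ?_ congr(((0 : ℝ), $hB))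
  have ht : ∀ᶠ y : ℝ × E in 𝓝[Set.range (𝓘(ℝ, ℝ).prod I)] (extChartAt (𝓘(ℝ, ℝ).prod I) q q),
      y ∈ (extChartAt (𝓘(ℝ, ℝ).prod I) q).target := extChartAt_target_mem_nhdsWithin q
  have he (a : ℝ) (W : Π p : M, TangentSpace I p) := ht.mono fun y hy ↦
    mpullbackWithin_extChartAt_symm_prodField a W q (y := y) (by
      rw [extChartAt_prod] at hy; exact hy.2)
  have hm' : extChartAt (𝓘(ℝ, ℝ).prod I) q q ∈ Set.range (𝓘(ℝ, ℝ).prod I) :=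
    extChartAt_target_subset_range q (mem_extChartAt_target q)
  rw [Set.preimage_univ, Set.univ_inter]
  refine (EventuallyEq.lieBracketWithin_vectorField_eq_of_mem (he c U) (he d V) hm').trans ?_
  have e0 : extChartAt (𝓘(ℝ, ℝ).prod I) q q = (q.1, extChartAt I q.2 q.2) := by
    rw [extChartAt_prod]; rfl
  rw [hr, e0]
  refine congr($(key d c hV _) - $(key c d hU _)).trans ?_
  exact Prod.ext (sub_zero _) rfl
end ProdField

section Hessian

variable {E : Type*} [NormedAddCommGroup E] [NormedSpace ℝ E]
  {H : Type*} [TopologicalSpace H] {I : ModelWithCorners ℝ E H}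
  {M : Type*} [TopologicalSpace M] [ChartedSpace H M]

theorem mvfderiv_comp_snd {f : M → ℝ} {q : ℝ × M} (hf : MDifferentiableAt I 𝓘(ℝ, ℝ) f q.2)
    (v : ℝ × E) :
    mvfderiv (𝓘(ℝ, ℝ).prod I) (fun y : ℝ × M ↦ f y.2) q v = mvfderiv I f q.2 v.2 := by
  have h := mvfderiv_comp_apply (I := I) (I' := 𝓘(ℝ, ℝ).prod I) (g := f) (f := Prod.snd) q hf
    mdifferentiableAt_snd v
  rw [mfderiv_snd] at h
  exact h

theorem mvfderiv_eq_zero_of_mem_mongeTangentSpace {f : M → ℝ} {q : ℝ × M}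
    (hf : MDifferentiableAt I 𝓘(ℝ, ℝ) f q.2) (hq : q ∈ mongeHypersurface f) {φ : ℝ × M → ℝ}
    (hφ : MDifferentiableAt (𝓘(ℝ, ℝ).prod I) 𝓘(ℝ, ℝ) φ q)
    (h0 : ∀ᶠ x in 𝓝[mongeHypersurface f] q, φ x = 0)
    {v : TangentSpace (𝓘(ℝ, ℝ).prod I) q} (hv : v ∈ mongeTangentSpace (I := I) f q) :
    mvfderiv (𝓘(ℝ, ℝ).prod I) φ q v = 0 := by
  obtain ⟨t, p⟩ := q
  obtain rfl : t = f p := hq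
  obtain ⟨w, rfl⟩ := hv
  have hγ : MDifferentiableAt I (𝓘(ℝ, ℝ).prod I) (fun p : M ↦ (f p, p)) p :=
    hf.prodMk mdifferentiableAt_id
  have ht : Tendsto (fun p : M ↦ (f p, p)) (𝓝 p) (𝓝[mongeHypersurface f] (f p, p)) :=
    tendsto_nhdsWithin_iff.2 ⟨hγ.continuousAt, Eventually.of_forall fun _ ↦ rfl⟩
  have he : φ ∘ (fun p : M ↦ (f p, p)) =ᶠ[𝓝 p] fun _ ↦ 0 := ht.eventually h0
  have h := mvfderiv_comp_apply (f := fun p : M ↦ (f p, p)) p hφ hγ w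
  rw [mvfderiv_congr_of_eventuallyEq he, mvfderiv_const] at h
  exact h.symm

/-- The function `(t, p) ↦ f p - t` on `ℝ × M`, whose zero set is the hypersurface `t = f p`. -/
def mongeFunction (f : C^∞⟮I, M; ℝ⟯) : C^∞⟮𝓘(ℝ, ℝ).prod I, ℝ × M; ℝ⟯ :=
  ⟨fun q ↦ f q.2 - q.1, (f.contMDiff.comp contMDiff_snd).sub contMDiff_fst⟩

theorem mvfderiv_mongeFunction (f : C^∞⟮I, M; ℝ⟯) (q : ℝ × M) (v : ℝ × E) :
    mvfderiv (𝓘(ℝ, ℝ).prod I) (mongeFunction f) q v = mvfderiv I f q.2 v.2 - v.1 := by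
  have hf : MDifferentiableAt I 𝓘(ℝ, ℝ) f q.2 := f.contMDiff.mdifferentiable (by simp) _
  have h1 : mvfderiv (𝓘(ℝ, ℝ).prod I) (Prod.fst : ℝ × M → ℝ) q v = v.1 := by
    simp only [mvfderiv, mfderiv_fst]
    rfl
  have h2 := mvfderiv_sub (I := 𝓘(ℝ, ℝ).prod I) (x := q) (g := fun y : ℝ × M ↦ f y.2)
    (g' := Prod.fst) (hf.comp q mdifferentiableAt_snd) mdifferentiableAt_fst
  refine congr($h2 v).trans ?_
  exact congr($(mvfderiv_comp_snd hf v) - $h1)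

variable [IsManifold I ∞ M]

theorem ambientMetric_inner_mongeNormal [FiniteDimensional ℝ E] (g : SemiRiemannianMetric I M)
    (f : C^∞⟮I, M; ℝ⟯) (q : ℝ × M) (v : TangentSpace (𝓘(ℝ, ℝ).prod I) q) :
    (ambientMetric g).inner q v (mongeNormal g f q) =
      mvfderiv (𝓘(ℝ, ℝ).prod I) (mongeFunction f) q v := by
  refine (ambientInner_apply' g q v (mongeNormal g f q)).trans ?_
  refine Eq.trans ?_ (mvfderiv_mongeFunction f q v).symm
  have h1 : (mongeNormal g f q : ℝ × E) = ((1 : ℝ), (g.grad f q.2 : E)) :=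
    Prod.ext (add_zero (1 : ℝ)) (zero_add (g.grad f q.2 : E))
  have h2 : g.inner q.2 (v : ℝ × E).2 (g.grad f q.2) = mvfderiv I f q.2 (v : ℝ × E).2 :=
    (g.symm q.2 _ _).trans congr($(g.inner_sharp q.2 (mvfderiv I f q.2)) _)
  rw [h1]
  refine congr(-((v : ℝ × E).1 * 1) + $h2).trans ?_
  ring

theorem ambientMetric_inner_prodField (g : SemiRiemannianMetric I M) (a b : ℝ)
    (U V : Π p : M, TangentSpace I p) (q : ℝ × M) :
    (ambientMetric g).inner q (prodField a U q) (prodField b V q) =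
      -(a * b) + g.inner q.2 (U q.2) (V q.2) :=
  ambientInner_apply' g q _ _

theorem mvfderiv_inner_prodField (g : SemiRiemannianMetric I M) (a b : ℝ)
    {U V : Π p : M, TangentSpace I p} {q : ℝ × M} (hU : MDiffAt (T% U) q.2)
    (hV : MDiffAt (T% V) q.2) (v : ℝ × E) :
    mvfderiv (𝓘(ℝ, ℝ).prod I)
        (fun y ↦ (ambientMetric g).inner y (prodField a U y) (prodField b V y)) q v =
      mvfderiv I (fun y ↦ g.inner y (U y) (V y)) q.2 v.2 := by
  have hd := g.mdifferentiableAt_inner hU hV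
  simp only [ambientMetric_inner_prodField]
  have h := mvfderiv_add (I := 𝓘(ℝ, ℝ).prod I) (x := q) (g := fun _ : ℝ × M ↦ -(a * b))
    (g' := fun y ↦ g.inner y.2 (U y.2) (V y.2)) mdifferentiableAt_const
    (hd.comp q mdifferentiableAt_snd)
  rw [mvfderiv_const, zero_add] at h
  exact congr($h v).trans (mvfderiv_comp_snd hd v)

/-- On lifted fields, the Levi-Civita connection of `-dx⁰ ⊗ dx⁰ + π^* g` is that of `g`. -/
theorem inner_leviCivita_prodField [FiniteDimensional ℝ E] (g : SemiRiemannianMetric I M)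
    (a b c : ℝ) {U V W : Π p : M, TangentSpace I p} {q : ℝ × M} (hU : MDiffAt (T% U) q.2)
    (hV : MDiffAt (T% V) q.2) (hW : MDiffAt (T% W) q.2) :
    (ambientMetric g).inner q
        (leviCivita (ambientMetric g) (prodField b V) q (prodField a U q)) (prodField c W q) =
      g.inner q.2 (leviCivita g V q.2 (U q.2)) (W q.2) := by
  have : CompleteSpace E := FiniteDimensional.complete ℝ E
  have h1 := (isLeviCivita_leviCivita (ambientMetric g)).koszul
    (mdifferentiableAt_prodField a hU) (mdifferentiableAt_prodField b hV)
    (mdifferentiableAt_prodField c hW)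
  have h2 := (isLeviCivita_leviCivita g).koszul hU hV hW
  rw [mlieBracket_prodField a b hU hV, mlieBracket_prodField a c hU hW,
    mlieBracket_prodField b c hV hW] at h1
  have d1 := mvfderiv_inner_prodField g b c hV hW (prodField a U q)
  have d2 := mvfderiv_inner_prodField g a c hU hW (prodField b V q)
  have d3 := mvfderiv_inner_prodField g a b hU hV (prodField c W q)
  change _ = mvfderiv I (fun y ↦ g.inner y (V y) (W y)) q.2 (U q.2) at d1
  change _ = mvfderiv I (fun y ↦ g.inner y (U y) (W y)) q.2 (V q.2) at d2
  change _ = mvfderiv I (fun y ↦ g.inner y (U y) (V y)) q.2 (W q.2) at d3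
  rw [d1, d2, d3] at h1
  simp only [ambientMetric_inner_prodField] at h1
  linarith

theorem hessian_mongeFunction [FiniteDimensional ℝ E] (g : SemiRiemannianMetric I M)
    (f : C^∞⟮I, M; ℝ⟯) (q : ℝ × M) (u v : ℝ × E) :
    hessian (ambientMetric g) (mongeFunction f) q u v = hessian g f q.2 u.2 v.2 := by
  have hex (w : TangentSpace I q.2) :
      ∃ W : Π p : M, TangentSpace I p, MDiffAt (T% W) q.2 ∧ W q.2 = w :=
    ⟨FiberBundle.extend E w, FiberBundle.mdifferentiableAt_extend .., by simp⟩
  obtain ⟨U, hU, hUq⟩ := hex u.2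
  obtain ⟨V, hV, hVq⟩ := hex v.2
  obtain ⟨W, hW, hWq⟩ := hex (g.grad f q.2)
  have hu : prodField u.1 U q = u := Prod.ext rfl hUq
  have hv : prodField v.1 V q = v := Prod.ext rfl hVq
  have hw : prodField 1 W q = mongeNormal g f q :=
    Prod.ext (add_zero (1 : ℝ)).symm (hWq.trans (zero_add (g.grad f q.2 : E)).symm)
  have hV' := mdifferentiableAt_prodField v.1 hV
  have h1 := hessian_apply (ambientMetric g) (mongeFunction f) q u hV'
  have h2 := hessian_apply g f q.2 u.2 hV
  have h3 := inner_leviCivita_prodField g u.1 v.1 1 hU hV hW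
  rw [hw, ambientMetric_inner_mongeNormal, hu, hWq, g.symm, SemiRiemannianMetric.grad,
    g.inner_sharp, hUq] at h3
  have hd := mdifferentiableAt_mvfderiv f.contMDiff hV
  have h4 : mvfderiv (𝓘(ℝ, ℝ).prod I)
      (fun y ↦ mvfderiv (𝓘(ℝ, ℝ).prod I) (mongeFunction f) y (prodField v.1 V y)) q u =
      mvfderiv I (fun y ↦ mvfderiv I f y (V y)) q.2 u.2 := by
    have e : (fun y ↦ mvfderiv (𝓘(ℝ, ℝ).prod I) (mongeFunction f) y (prodField v.1 V y)) =
        (fun y : ℝ × M ↦ mvfderiv I f y.2 (V y.2)) - fun _ ↦ v.1 :=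
      funext fun y ↦ mvfderiv_mongeFunction f y _
    have h := mvfderiv_sub (I := 𝓘(ℝ, ℝ).prod I) (x := q)
      (g := fun y : ℝ × M ↦ mvfderiv I f y.2 (V y.2)) (g' := fun _ ↦ v.1)
      (hd.comp q mdifferentiableAt_snd) mdifferentiableAt_const
    rw [mvfderiv_const, sub_zero] at h
    rw [e]
    exact congr($h u).trans (mvfderiv_comp_snd hd u)
  rw [h4, h3, hv] at h1
  rw [hVq] at h2
  exact h1.trans h2.symm

end Hessian

section Along

variable {E : Type*} [NormedAddCommGroup E] [NormedSpace ℝ E]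
  {H : Type*} [TopologicalSpace H] {I : ModelWithCorners ℝ E H}
  {M : Type*} [TopologicalSpace M] [ChartedSpace H M] [IsManifold I ∞ M]

theorem IsTangentFieldOnMonge.exists_extension {f : C^∞⟮I, M; ℝ⟯}
    {Y : Π q : ℝ × M, TangentSpace (𝓘(ℝ, ℝ).prod I) q} (hY : IsTangentFieldOnMonge f Y)
    (q : ℝ × M) :
    ∃ Z : Π x : ℝ × M, TangentSpace (𝓘(ℝ, ℝ).prod I) x,
      ContMDiffAt (𝓘(ℝ, ℝ).prod I) (𝓘(ℝ, ℝ).prod I).tangent ∞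
          (fun x ↦ (⟨x, Z x⟩ : TangentBundle (𝓘(ℝ, ℝ).prod I) (ℝ × M))) q ∧
        ∀ᶠ x in 𝓝[mongeHypersurface f] q, Z x = Y x := by
  have h1 : ContMDiff (𝓘(ℝ, ℝ).prod I) (𝓘(ℝ, ℝ).prod I).tangent ∞
      (fun x : ℝ × M ↦ (⟨(f x.2, x.2), Y (f x.2, x.2)⟩ :
        TangentBundle (𝓘(ℝ, ℝ).prod I) (ℝ × M))) :=
    hY.contMDiffOn.comp_contMDiff ((f.contMDiff.comp contMDiff_snd).prodMk contMDiff_snd)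
      fun _ ↦ rfl
  have h2 := contMDiff_equivTangentBundleProd.comp h1
  have h3 := contMDiff_snd_tangentBundle_modelSpace ℝ 𝓘(ℝ, ℝ) |>.comp (contMDiff_fst.comp h2)
  have h4 := contMDiff_snd.comp h2
  have h5 : ContMDiffAt (𝓘(ℝ, ℝ).prod I) 𝓘(ℝ, ℝ).tangent ∞
      (fun x : ℝ × M ↦ (⟨x.1, (Y (f x.2, x.2) : ℝ × E).1⟩ : TangentBundle 𝓘(ℝ, ℝ) ℝ)) q :=
    contMDiffAt_tangentBundle_modelSpace contMDiffAt_fst (h3 q)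
  refine ⟨fun x ↦ (Y (f x.2, x.2) : ℝ × E), ?_, ?_⟩
  · exact (contMDiff_equivTangentBundleProd_symm (n := ∞)).contMDiffAt.comp q
      (h5.prodMk (h4 q))
  · filter_upwards [self_mem_nhdsWithin] with x hx
    obtain ⟨t, p⟩ := x
    obtain rfl : t = f p := hx
    rfl

end Along

end

theorem mainTheorem1 {E : Type*} [NormedAddCommGroup E] [NormedSpace ℝ E] [FiniteDimensional ℝ E]
    {H : Type*} [TopologicalSpace H] {I : ModelWithCorners ℝ E H}
    {M : Type*} [TopologicalSpace M] [ChartedSpace H M] [IsManifold I ∞ M]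
    [BoundarylessManifold I M]
    (g : SemiRiemannianMetric I M) (F : C^∞⟮I, M; ℝ⟯)
    (X Y : Π q : ℝ × M, TangentSpace (𝓘(ℝ, ℝ).prod I) q)
    (hX : IsTangentFieldOnMonge F X) (hY : IsTangentFieldOnMonge F Y)
    (q : ℝ × M) (hq : q ∈ mongeHypersurface F) :
    secondFundamentalForm (ambientMetric g) (mongeHypersurface F) (mongeNormal g F) X Y q =
      -hessian g F q.2
        (mfderiv (𝓘(ℝ, ℝ).prod I) I (Prod.snd : ℝ × M → M) q (X q))
        (mfderiv (𝓘(ℝ, ℝ).prod I) I (Prod.snd : ℝ × M → M) q (Y q)) := by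
  have hF (p : M) : MDifferentiableAt I 𝓘(ℝ, ℝ) F p := F.contMDiff.mdifferentiable (by simp) p
  have hex := hY.exists_extension q
  rw [secondFundamentalForm, covDerivAlong, dif_pos hex]
  obtain ⟨hZ, hZY⟩ := hex.choose_spec
  generalize hex.choose = Z at hZ hZY
  have hZ' : MDiffAt (T% Z) q := hZ.mdifferentiableAt (by simp)
  have hd := mdifferentiableAt_mvfderiv (mongeFunction F).contMDiff hZ'
  have htan : ∀ᶠ x in 𝓝[mongeHypersurface F] q,
      mvfderiv (𝓘(ℝ, ℝ).prod I) (mongeFunction F) x (Z x) = 0 := by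
    filter_upwards [hZY, self_mem_nhdsWithin] with x hxZ hx
    rw [hxZ]
    refine mvfderiv_eq_zero_of_mem_mongeTangentSpace (hF _) hx
      ((mongeFunction F).contMDiff.mdifferentiable (by simp) x) ?_ (hY.tangent x hx)
    filter_upwards [self_mem_nhdsWithin] with y hy
    exact sub_eq_zero.2 (Eq.symm hy)
  have h1 := hessian_apply (ambientMetric g) (mongeFunction F) q (X q) hZ'
  rw [mvfderiv_eq_zero_of_mem_mongeTangentSpace (hF _) hq hd htan (hX.tangent q hq), zero_sub,
    hZY.self_of_nhdsWithin hq] at h1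
  rw [ambientMetric_inner_mongeNormal, mfderiv_snd, eq_neg_iff_add_eq_zero, add_comm,
    ← eq_neg_iff_add_eq_zero, ← h1]
  exact (hessian_mongeFunction g F q (X q) (Y q)).symm
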